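/- A triangulation of the $2$-sphere here means a finite collection of triangles glued along their sides in pairs so that the result is a sphere; two triangles may share several edges. The degree of a vertex is the number of triangle corners around it. A coloring of the faces of such a triangulation with two colors, black and white, is called good if around each vertex the number of black faces is congruent modulo $3$ to the number of white faces (counted by corners at that vertex). The fold count of a coloring is the number of edges having a black face on one side and a white face on the other. Theorem. Let $\mathcal T$ be any triangulation of the $2$-sphere with degree sequence $6,\dots,6,2,2,2$ (that is, exactly three vertices have degree $2$ and all other vertices, if any, have degree $6$), and let $\mathcal C$ be any good coloring of the faces of $\mathcal T$. Let $f$ be the fold count of $\mathcal C$ and let $F$ be the number of faces of $\mathcal T$. Then the Eisenstein isoperimetric ratio $\eta(\mathcal C) = f^2/F$ satisfies $$\eta(\mathcal C) \geq 3.$$ -/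

import Mathlib

open Equiv

/-- A (generalized) triangulation of the 2-sphere, given as a finite oriented combinatorial map.
`D` is the set of darts: the sides of the triangles, each directed counterclockwise along its
triangle. Triangles are glued along sides in pairs, reversing direction. As usual for such gluings,
two triangles may share more than one edge (this is forced by vertices of degree 2). -/
structure SphereTriangulation (D : Type*) [Finite D] where
  /-- the next side, counterclockwise, of the same triangle -/
  next : Perm D
  /-- the side of a triangle to which a given side is glued, i.e. the reversed dart -/
  opp : Perm D
  /-- faces are triangles -/
  next_next_next : ∀ d, next (next (next d)) = d
  next_ne : ∀ d, next d ≠ d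
  /-- sides are glued in pairs -/
  opp_opp : ∀ d, opp (opp d) = d
  opp_ne : ∀ d, opp d ≠ d
  /-- the surface is non-empty and connected -/
  nonempty : Nonempty D
  connected : MulAction.IsPretransitive (Subgroup.closure ({next, opp} : Set (Perm D))) D
  /-- the surface has Euler characteristic 2: `V + F = E + 2`, where the vertices are the cycles
  of `d ↦ opp (next⁻¹ d)`, the faces those of `next`, and the edges those of `opp` -/
  euler : Nat.card (Quotient (Perm.SameCycle.setoid (opp * next⁻¹)))
      + Nat.card (Quotient (Perm.SameCycle.setoid next))
    = Nat.card (Quotient (Perm.SameCycle.setoid opp)) + 2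

namespace SphereTriangulation

variable {D : Type*} [Finite D] (T : SphereTriangulation D)

/-- Counterclockwise rotation about the initial vertex of a dart: the side of the triangle of `d`
that precedes `d` ends at the initial vertex of `d`; its reverse starts there. -/
def rot : Perm D := T.opp * T.next⁻¹

/-- Vertices: a vertex is the cycle of all darts that start at it. -/
abbrev Vertex : Type _ := Quotient (Perm.SameCycle.setoid T.rot)

/-- Edges: an edge is a pair of opposite darts. -/
abbrev Edge : Type _ := Quotient (Perm.SameCycle.setoid T.opp)

/-- Faces: a face is the cycle of its three sides. -/
abbrev Face : Type _ := Quotient (Perm.SameCycle.setoid T.next)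

/-- The initial vertex of a dart. -/
def vertexOf (d : D) : T.Vertex := Quotient.mk _ d

/-- The edge carrying a dart. -/
def edgeOf (d : D) : T.Edge := Quotient.mk _ d

/-- The triangle of which a dart is a side. -/
def faceOf (d : D) : T.Face := Quotient.mk _ d

/-- The degree of a vertex: the number of darts starting at it, which is also the number of
triangle corners around it. -/
noncomputable def degree (v : T.Vertex) : ℕ := {d : D | T.vertexOf d = v}.ncard

/-- The degree sequence is `6, …, 6, 2, 2, 2`: exactly three vertices have degree 2, and all the
others (possibly none) have degree 6. -/
def HasDegreeSequenceSixTwoTwoTwo : Prop :=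
  {v : T.Vertex | T.degree v = 2}.ncard = 3 ∧ ∀ v : T.Vertex, T.degree v ≠ 2 → T.degree v = 6

/-- A 2-coloring of the faces: `true` is black and `false` is white. -/
abbrev Coloring : Type _ := T.Face → Bool

/-- The number of triangles of color `b` around the vertex `v` (counted by their corners at `v`:
the dart `d` starting at `v` marks the corner at `v` of the triangle that has `d` as a side). -/
noncomputable def colorCount (c : T.Coloring) (b : Bool) (v : T.Vertex) : ℕ :=
  {d : D | T.vertexOf d = v ∧ c (T.faceOf d) = b}.ncard

/-- A face 2-coloring is good if around each vertex the number of black faces is congruent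
modulo 3 to the number of white faces. -/
def IsGood (c : T.Coloring) : Prop :=
  ∀ v : T.Vertex, T.colorCount c true v ≡ T.colorCount c false v [MOD 3]

/-- The fold count: the number of edges that have a black face on one side and a white face on
the other. -/
noncomputable def foldCount (c : T.Coloring) : ℕ :=
  {e : T.Edge | ∃ d : D, T.edgeOf d = e ∧
    c (T.faceOf d) = true ∧ c (T.faceOf (T.opp d)) = false}.ncard

/-- The Eisenstein isoperimetric ratio `f ^ 2 / F` of a coloring, with `f` the fold count and `F`
the number of faces. -/
noncomputable def eta (c : T.Coloring) : ℝ :=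
  (T.foldCount c : ℝ) ^ 2 / (Nat.card T.Face : ℝ)

end SphereTriangulation

/-!
A good coloring of a triangulation with even degrees is a recipe for folding the sphere flat. Send
the triangles to triangles of the triangular lattice, preserving the orientation of the black ones
and reversing that of the white ones, and fold along the edges between the two colors. Around a
vertex with `b` black and `w` white corners the images turn by `b - w` sixths of a full turn. This
number is even since the degree is, and divisible by 3 since the coloring is good, so there is no
local obstruction; there is no global one because the sphere has no first cohomology
(`exists_potential`). Only the parity of the degrees 2 and 6 matters.

The images of the triangles of one color, counted with multiplicity, form a region whose boundary
has length at most `f`. The isoperimetric inequality of the triangular lattice says that a region of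
perimeter `f` has at most `f ^ 2 / 6` triangles, with equality for regular hexagons. Applied to both
colors it gives `F ≤ f ^ 2 / 3`.

Vanishing of the cohomology is a dimension count, with darts as vertices of the complex: the
coboundary and the transpose of the next differential both have one-dimensional kernel
because the surface is connected, and `V + F = E + 2` makes the dimensions match. It is used over
`ZMod 2` for the sign of the triangles, over `ZMod 3` for the direction of the edges, and over `ℚ`
for the position of the vertices (`exists_foldMap`).

For the isoperimetric inequality, a cell of the lattice is named by the three strips that contain
it, three integers with sum `-1` or `-2`. If `a`, `b`, `c` strips are available in the three
directions, they contain at most `(a + b + c) ^ 2 / 6` cells (`six_mul_card_cells_le`). Slicing by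
multiplicity turns this into a weighted inequality (`six_mul_sum_le_sq`), in which the
multiplicity of a cell is bounded by half the number of folds across any of its strips
(`two_mul_card_cell_le`); each fold crosses strips of exactly two directions.
-/

/-! ### Counting lattice cells in given strips -/

/-- The triples of `A × B × C` with sum `s`. -/
def sumFiber (A B C : Finset ℤ) (s : ℤ) : Finset (ℤ × ℤ × ℤ) :=
  (A ×ˢ B ×ˢ C).filter fun t => t.1 + t.2.1 + t.2.2 = s

lemma mem_sumFiber {A B C : Finset ℤ} {s : ℤ} {t : ℤ × ℤ × ℤ} :
    t ∈ sumFiber A B C s ↔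
      (t.1 ∈ A ∧ t.2.1 ∈ B ∧ t.2.2 ∈ C) ∧ t.1 + t.2.1 + t.2.2 = s := by
  simp [sumFiber]

/-- For each `x`, the hook formed by the pairs with `y` least or `z` greatest contains at most one
pair with `x + y + z = s`, because the sum increases along the hook. -/
lemma card_sumFiber_le_add (A B C : Finset ℤ) (s : ℤ) (hB : B.Nonempty) (hC : C.Nonempty) :
    (sumFiber A B C s).card ≤
      A.card + (sumFiber A (B.erase (B.min' hB)) (C.erase (C.max' hC)) s).card := by
  set y₀ := B.min' hB
  set z₀ := C.max' hC
  have hcover : sumFiber A B C s ⊆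
      (sumFiber A B C s).filter (fun t => t.2.1 = y₀ ∨ t.2.2 = z₀) ∪
        sumFiber A (B.erase y₀) (C.erase z₀) s := by
    intro t ht
    simp only [Finset.mem_union, Finset.mem_filter, mem_sumFiber, Finset.mem_erase] at ht ⊢
    tauto
  have hhook : ((sumFiber A B C s).filter (fun t => t.2.1 = y₀ ∨ t.2.2 = z₀)).card ≤ A.card := by
    refine Finset.card_le_card_of_injOn Prod.fst ?_ ?_
    · intro t ht
      simp only [Finset.coe_filter, mem_sumFiber, Set.mem_ofPred_eq] at ht
      exact ht.1.1.1
    · rintro ⟨x, y, z⟩ ht ⟨x', y', z'⟩ ht' hx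
      simp only [Finset.coe_filter, mem_sumFiber, Set.mem_ofPred_eq] at ht ht' hx
      subst hx
      have h1 := B.min'_le y ht.1.1.2.1
      have h2 := B.min'_le y' ht'.1.1.2.1
      have h3 := C.le_max' z ht.1.1.2.2
      have h4 := C.le_max' z' ht'.1.1.2.2
      have h5 : y = y' ∧ z = z' := by
        change y₀ ≤ y at h1
        change y₀ ≤ y' at h2
        change z ≤ z₀ at h3
        change z' ≤ z₀ at h4
        omega
      rw [h5.1, h5.2]
  calc _ ≤ _ := Finset.card_le_card hcover
    _ ≤ _ := Finset.card_union_le _ _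
    _ ≤ _ := by gcongr

/-- Peeling off `t` hooks. For intervals the optimal `t` is about half of `#B + #C - #A`. -/
lemma card_sumFiber_le (A B C : Finset ℤ) (s : ℤ) (t : ℕ) (hB : t ≤ B.card) (hC : t ≤ C.card) :
    (sumFiber A B C s).card ≤ t * A.card + (B.card - t) * (C.card - t) := by
  induction t generalizing B C with
  | zero =>
    have : (sumFiber A B C s).card ≤ (B ×ˢ C).card := by
      refine Finset.card_le_card_of_injOn Prod.snd ?_ ?_
      · intro t ht
        have ht := mem_sumFiber.1 ht
        simpa using ht.1.2
      · rintro ⟨x, y, z⟩ ht ⟨x', y', z'⟩ ht' h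
        have ht := mem_sumFiber.1 ht
        have ht' := mem_sumFiber.1 ht'
        simp only [Prod.mk.injEq] at h ht ht' ⊢
        omega
    simpa using this
  | succ t ih =>
    have hB' : B.Nonempty := Finset.card_pos.1 (by omega)
    have hC' : C.Nonempty := Finset.card_pos.1 (by omega)
    have h1 := card_sumFiber_le_add A B C s hB' hC'
    have e1 := Finset.card_erase_of_mem (B.min'_mem hB')
    have e2 := Finset.card_erase_of_mem (C.max'_mem hC')
    have h2 := ih (B.erase (B.min' hB')) (C.erase (C.max' hC')) (by omega) (by omega)
    rw [e1, e2, Nat.sub_sub, Nat.sub_sub, Nat.add_comm 1 t] at h2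
    rw [Nat.add_mul]
    omega

/-- The set of the integers `2x` and `2x + 1` with `x ∈ A`: the half-width strips inside the strips
of `A`. -/
def halve (A : Finset ℤ) : Finset ℤ := (A ×ˢ ({0, 1} : Finset ℤ)).image fun p => 2 * p.1 + p.2

lemma mem_halve {A : Finset ℤ} {x : ℤ} : x ∈ halve A ↔ x / 2 ∈ A := by
  simp only [halve, Finset.mem_image, Finset.mem_product, Finset.mem_insert,
    Finset.mem_singleton, Prod.exists]
  constructor
  · rintro ⟨a, i, ⟨ha, hi⟩, rfl⟩
    have : (2 * a + i) / 2 = a := by omega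
    rwa [this]
  · intro h
    exact ⟨x / 2, x % 2, ⟨h, by omega⟩, by omega⟩

lemma card_halve (A : Finset ℤ) : (halve A).card = 2 * A.card := by
  rw [halve, Finset.card_image_of_injOn, Finset.card_product]
  · simp [Nat.mul_comm]
  · rintro ⟨a, i⟩ h ⟨a', i'⟩ h' e
    simp only [Finset.coe_product, Finset.coe_insert, Finset.coe_singleton, Set.mem_prod,
      Set.mem_insert_iff, Set.mem_singleton_iff, Prod.mk.injEq] at h h' e ⊢
    omega

/-- The cells of the triangular lattice whose three strips have coordinates in `A`, `B` and `C`. -/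
def cells (A B C : Finset ℤ) : Finset (ℤ × ℤ × ℤ) :=
  (A ×ˢ B ×ˢ C).filter fun t => t.1 + t.2.1 + t.2.2 = -1 ∨ t.1 + t.2.1 + t.2.2 = -2

lemma mem_cells {A B C : Finset ℤ} {t : ℤ × ℤ × ℤ} :
    t ∈ cells A B C ↔ (t.1 ∈ A ∧ t.2.1 ∈ B ∧ t.2.2 ∈ C) ∧
      (t.1 + t.2.1 + t.2.2 = -1 ∨ t.1 + t.2.1 + t.2.2 = -2) := by
  simp [cells]

lemma card_cells_le_add (A B C : Finset ℤ) :
    (cells A B C).card ≤ (sumFiber A B C (-1)).card + (sumFiber A B C (-2)).card := by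
  refine le_trans (Finset.card_le_card ?_) (Finset.card_union_le _ _)
  intro t ht
  rw [Finset.mem_union, mem_sumFiber, mem_sumFiber]
  rw [mem_cells] at ht
  tauto

/-- Each cell splits into four cells of half the size. -/
lemma four_mul_card_cells_le (A B C : Finset ℤ) :
    4 * (cells A B C).card ≤ (cells (halve A) (halve B) (halve C)).card := by
  have hmaps : ∀ t ∈ cells (halve A) (halve B) (halve C),
      (t.1 / 2, t.2.1 / 2, t.2.2 / 2) ∈ cells A B C := by
    intro t ht
    simp only [mem_cells, mem_halve] at ht ⊢
    exact ⟨ht.1, by omega⟩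
  rw [Finset.card_eq_sum_card_fiberwise hmaps, Nat.mul_comm, ← smul_eq_mul]
  refine Finset.card_nsmul_le_sum _ _ _ ?_
  rintro ⟨x, y, z⟩ ht
  simp only [mem_cells] at ht
  obtain ⟨⟨hx, hy, hz⟩, h | h⟩ := ht
  · have : ({(2 * x, 2 * y, 2 * z), (2 * x + 1, 2 * y, 2 * z), (2 * x, 2 * y + 1, 2 * z),
        (2 * x, 2 * y, 2 * z + 1)} : Finset (ℤ × ℤ × ℤ)).card = 4 := by
      repeat rw [Finset.card_insert_of_notMem (by simp)]
      simp
    rw [← this]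
    refine Finset.card_le_card ?_
    intro t ht
    simp only [Finset.mem_insert, Finset.mem_singleton] at ht
    simp only [Finset.mem_filter, mem_cells, mem_halve, Prod.mk.injEq]
    have : t.1 / 2 = x ∧ t.2.1 / 2 = y ∧ t.2.2 / 2 = z := by
      rcases ht with rfl | rfl | rfl | rfl <;> (dsimp only; omega)
    refine ⟨⟨by rw [this.1, this.2.1, this.2.2]; exact ⟨hx, hy, hz⟩, ?_⟩, this⟩
    rcases ht with rfl | rfl | rfl | rfl <;> (dsimp only; omega)
  · have : ({(2 * x + 1, 2 * y + 1, 2 * z + 1), (2 * x, 2 * y + 1, 2 * z + 1),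
        (2 * x + 1, 2 * y, 2 * z + 1), (2 * x + 1, 2 * y + 1, 2 * z)} :
        Finset (ℤ × ℤ × ℤ)).card = 4 := by
      repeat rw [Finset.card_insert_of_notMem (by simp)]
      simp
    rw [← this]
    refine Finset.card_le_card ?_
    intro t ht
    simp only [Finset.mem_insert, Finset.mem_singleton] at ht
    simp only [Finset.mem_filter, mem_cells, mem_halve, Prod.mk.injEq]
    have : t.1 / 2 = x ∧ t.2.1 / 2 = y ∧ t.2.2 / 2 = z := by
      rcases ht with rfl | rfl | rfl | rfl <;> (dsimp only; omega)
    refine ⟨⟨by rw [this.1, this.2.1, this.2.2]; exact ⟨hx, hy, hz⟩, ?_⟩, this⟩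
    rcases ht with rfl | rfl | rfl | rfl <;> (dsimp only; omega)

/-- The isoperimetric inequality for sets of cells, in terms of the numbers of strips they meet. The
cells are halved first so that the optimal number of hooks is an integer, without which the
inequality would be lost to rounding. -/
theorem six_mul_card_cells_le (A B C : Finset ℤ) :
    6 * (cells A B C).card ≤ (A.card + B.card + C.card) ^ 2 := by
  have hN := card_cells_le_add A B C
  set N := (cells A B C).card with hNdef
  set a := A.card with ha
  set b := B.card with hb
  set c := C.card with hc
  -- beyond the triangle inequalities the optimal number of hooks is outside the admissible range,
  -- and its nearest endpoint suffices
  by_cases h1 : b + c < a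
  · have e1 := card_sumFiber_le A B C (-1) 0 (by omega) (by omega)
    have e2 := card_sumFiber_le A B C (-2) 0 (by omega) (by omega)
    have : N ≤ 2 * (b * c) := by
      simp only [Nat.zero_mul, Nat.zero_add, Nat.sub_zero, ← hb, ← hc] at e1 e2
      omega
    zify at *
    nlinarith [sq_nonneg ((b : ℤ) - c)]
  by_cases h2 : a + b < c
  · have e1 := card_sumFiber_le A B C (-1) b le_rfl (by omega)
    have e2 := card_sumFiber_le A B C (-2) b le_rfl (by omega)
    have : N ≤ 2 * (b * a) := by
      simp only [← hb, Nat.sub_self, Nat.zero_mul, Nat.add_zero, ← ha] at e1 e2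
      omega
    zify at *
    nlinarith [sq_nonneg ((b : ℤ) - a)]
  by_cases h3 : a + c < b
  · have e1 := card_sumFiber_le A B C (-1) c (by omega) le_rfl
    have e2 := card_sumFiber_le A B C (-2) c (by omega) le_rfl
    have : N ≤ 2 * (c * a) := by
      simp only [← hc, Nat.sub_self, Nat.mul_zero, Nat.add_zero, ← ha] at e1 e2
      omega
    zify at *
    nlinarith [sq_nonneg ((c : ℤ) - a)]
  have h4 := four_mul_card_cells_le A B C
  have h5 := card_cells_le_add (halve A) (halve B) (halve C)
  obtain ⟨t, ht⟩ : ∃ t, t + a = b + c := ⟨b + c - a, by omega⟩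
  obtain ⟨p, hp⟩ : ∃ p, p + t = 2 * b := ⟨2 * b - t, by omega⟩
  obtain ⟨q, hq⟩ : ∃ q, q + t = 2 * c := ⟨2 * c - t, by omega⟩
  have e1 := card_sumFiber_le (halve A) (halve B) (halve C) (-1) t
    (by rw [card_halve]; omega) (by rw [card_halve]; omega)
  have e2 := card_sumFiber_le (halve A) (halve B) (halve C) (-2) t
    (by rw [card_halve]; omega) (by rw [card_halve]; omega)
  rw [card_halve, card_halve, card_halve, ← ha, ← hb, ← hc, ← hp, ← hq, Nat.add_sub_cancel,
    Nat.add_sub_cancel] at e1 e2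
  have h6 : 4 * N ≤ 2 * (t * (2 * a) + p * q) := by omega
  have ht' : (t : ℤ) = b + c - a := by omega
  have hp' : (p : ℤ) = a + b - c := by omega
  have hq' : (q : ℤ) = a + c - b := by omega
  zify at h6 ⊢
  rw [ht', hp', hq'] at h6
  nlinarith [sq_nonneg ((a : ℤ) - b), sq_nonneg ((b : ℤ) - c), sq_nonneg ((c : ℤ) - a)]

lemma sum_range_card_filter_lt {ι : Type*} (I : Finset ι) (f : ι → ℕ) (K : ℕ)
    (hK : ∀ x ∈ I, f x ≤ K) :
    ∑ k ∈ Finset.range K, (I.filter fun x => k < f x).card = ∑ x ∈ I, f x := by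
  simp only [Finset.card_filter]
  rw [Finset.sum_comm]
  refine Finset.sum_congr rfl fun x hx => ?_
  rw [← Finset.card_filter]
  have : (Finset.range K).filter (fun k => k < f x) = Finset.range (f x) := by
    ext k
    have := hK x hx
    simp only [Finset.mem_filter, Finset.mem_range]
    omega
  rw [this, Finset.card_range]

/-- The weighted form of `six_mul_card_cells_le`, applied to the cells of weight more than `k` for
each `k`. -/
theorem six_mul_sum_le_sq (I : Finset ℤ) (α β γ : ℤ → ℕ) (w : ℤ × ℤ × ℤ → ℕ)
    (hα : ∀ t, w t ≤ α t.1) (hβ : ∀ t, w t ≤ β t.2.1) (hγ : ∀ t, w t ≤ γ t.2.2)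
    (hw : ∀ t, w t ≠ 0 → t.1 + t.2.1 + t.2.2 = -1 ∨ t.1 + t.2.1 + t.2.2 = -2) :
    6 * ∑ t ∈ I ×ˢ I ×ˢ I, w t ≤ (∑ x ∈ I, α x + ∑ x ∈ I, β x + ∑ x ∈ I, γ x) ^ 2 := by
  set K := ∑ x ∈ I, α x + ∑ x ∈ I, β x + ∑ x ∈ I, γ x with hK
  have kα : ∀ x ∈ I, α x ≤ K := fun x hx => by
    have := Finset.single_le_sum (f := α) (fun _ _ => Nat.zero_le _) hx
    omega
  have kβ : ∀ x ∈ I, β x ≤ K := fun x hx => by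
    have := Finset.single_le_sum (f := β) (fun _ _ => Nat.zero_le _) hx
    omega
  have kγ : ∀ x ∈ I, γ x ≤ K := fun x hx => by
    have := Finset.single_le_sum (f := γ) (fun _ _ => Nat.zero_le _) hx
    omega
  have kw : ∀ t ∈ I ×ˢ I ×ˢ I, w t ≤ K := fun t ht =>
    (hα t).trans (kα _ (Finset.mem_product.1 ht).1)
  rw [← sum_range_card_filter_lt _ w K kw, Finset.mul_sum]
  have hle : ∀ k ∈ Finset.range K, 6 * ((I ×ˢ I ×ˢ I).filter fun t => k < w t).card ≤
      ((I.filter fun x => k < α x).card + (I.filter fun x => k < β x).card +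
        (I.filter fun x => k < γ x).card) ^ 2 := by
    intro k _
    refine le_trans ?_ (six_mul_card_cells_le _ _ _)
    gcongr
    intro t ht
    simp only [Finset.mem_filter, Finset.mem_product] at ht
    simp only [mem_cells, Finset.mem_filter]
    have := hα t
    have := hβ t
    have := hγ t
    exact ⟨⟨⟨ht.1.1, by omega⟩, ⟨ht.1.2.1, by omega⟩, ⟨ht.1.2.2, by omega⟩⟩, hw t (by omega)⟩
  refine (Finset.sum_le_sum hle).trans ?_
  refine (Finset.sum_sq_le_sq_sum_of_nonneg (fun _ _ => Nat.zero_le _)).trans ?_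
  rw [Finset.sum_add_distrib, Finset.sum_add_distrib, sum_range_card_filter_lt I α K kα,
    sum_range_card_filter_lt I β K kβ, sum_range_card_filter_lt I γ K kγ]

/-! ### Cycles of darts and the first cohomology of the sphere -/

open scoped Classical in
lemma card_eq_mul_card_cycles {D : Type*} [Fintype D] (f : Perm D) (n : ℕ)
    (h : ∀ d, {d' | f.SameCycle d d'}.ncard = n) :
    Fintype.card D = n * Nat.card (Quotient (Perm.SameCycle.setoid f)) := by
  rw [← Finset.card_univ, Finset.card_eq_sum_card_fiberwise
    (f := fun d => (Quotient.mk (Perm.SameCycle.setoid f) d)) (t := Finset.univ) (by simp),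
    Finset.sum_const_nat (m := n), Nat.card_eq_fintype_card, Finset.card_univ, Nat.mul_comm]
  intro q _
  induction q using Quotient.inductionOn with
  | h d =>
    rw [← h d, Set.ncard_eq_toFinset_card']
    congr 1
    ext d'
    simp only [Finset.mem_filter, Finset.mem_univ, true_and, Set.mem_toFinset,
      Set.mem_ofPred_eq]
    exact Quotient.eq.trans Perm.sameCycle_comm

namespace SphereTriangulation

variable {D : Type*}

lemma faceOf_next [Finite D] (T : SphereTriangulation D) (d : D) :
    T.faceOf (T.next d) = T.faceOf d :=
  Quotient.sound (Perm.sameCycle_apply_left.2 (Perm.SameCycle.refl _ _))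

lemma edgeOf_opp [Finite D] (T : SphereTriangulation D) (d : D) :
    T.edgeOf (T.opp d) = T.edgeOf d :=
  Quotient.sound (Perm.sameCycle_apply_left.2 (Perm.SameCycle.refl _ _))

lemma vertexOf_rot [Finite D] (T : SphereTriangulation D) (d : D) :
    T.vertexOf (T.rot d) = T.vertexOf d :=
  Quotient.sound (Perm.sameCycle_apply_left.2 (Perm.SameCycle.refl _ _))

lemma vertexOf_next [Finite D] (T : SphereTriangulation D) (d : D) :
    T.vertexOf (T.next d) = T.vertexOf (T.opp d) := by
  rw [← T.vertexOf_rot (T.next d)]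
  simp [rot]

lemma zpow_mem_of_apply_mem {f : Perm D} {s : Set D} (h : ∀ d ∈ s, f d ∈ s)
    (h' : ∀ d ∈ s, f⁻¹ d ∈ s) {d : D} (hd : d ∈ s) (i : ℤ) : (f ^ i) d ∈ s := by
  induction i using Int.induction_on with
  | zero => simpa
  | succ i ih => rw [add_comm, zpow_add, zpow_one]; exact h _ ih
  | pred i ih => rw [sub_eq_add_neg, add_comm, zpow_add, zpow_neg_one]; exact h' _ ih

lemma next_inv_apply [Finite D] (T : SphereTriangulation D) (d : D) :
    T.next⁻¹ d = T.next (T.next d) := by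
  rw [Perm.inv_eq_iff_eq, T.next_next_next]

lemma opp_inv_apply [Finite D] (T : SphereTriangulation D) (d : D) : T.opp⁻¹ d = T.opp d := by
  rw [Perm.inv_eq_iff_eq, T.opp_opp]

lemma sameCycle_next_iff [Finite D] (T : SphereTriangulation D) (d d' : D) :
    T.next.SameCycle d d' ↔ d' = d ∨ d' = T.next d ∨ d' = T.next (T.next d) := by
  constructor
  · rintro ⟨i, rfl⟩
    refine zpow_mem_of_apply_mem (s := {x | x = d ∨ x = T.next d ∨ x = T.next (T.next d)})
      ?_ ?_ (Or.inl rfl) i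
    · rintro x (rfl | rfl | rfl) <;> simp [T.next_next_next]
    · rintro x (rfl | rfl | rfl) <;> simp [T.next_inv_apply, T.next_next_next]
  · rintro (rfl | rfl | rfl)
    · exact Perm.SameCycle.refl _ _
    · simp [Perm.SameCycle.refl]
    · simp [Perm.SameCycle.refl]

lemma sameCycle_opp_iff [Finite D] (T : SphereTriangulation D) (d d' : D) :
    T.opp.SameCycle d d' ↔ d' = d ∨ d' = T.opp d := by
  constructor
  · rintro ⟨i, rfl⟩
    refine zpow_mem_of_apply_mem (s := {x | x = d ∨ x = T.opp d}) ?_ ?_ (Or.inl rfl) i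
    · rintro x (rfl | rfl) <;> simp [T.opp_opp]
    · rintro x (rfl | rfl) <;> simp [T.opp_inv_apply, T.opp_opp]
  · rintro (rfl | rfl)
    · exact Perm.SameCycle.refl _ _
    · simp [Perm.SameCycle.refl]

lemma faceOf_eq_iff [Finite D] (T : SphereTriangulation D) {d d' : D} :
    T.faceOf d = T.faceOf d' ↔ d' = d ∨ d' = T.next d ∨ d' = T.next (T.next d) := by
  rw [← sameCycle_next_iff]
  exact Quotient.eq

lemma edgeOf_eq_iff [Finite D] (T : SphereTriangulation D) {d d' : D} :
    T.edgeOf d = T.edgeOf d' ↔ d' = d ∨ d' = T.opp d := by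
  rw [← sameCycle_opp_iff]
  exact Quotient.eq

lemma next_next_ne [Finite D] (T : SphereTriangulation D) (d : D) : T.next (T.next d) ≠ d := by
  intro h
  have := congrArg T.next h
  rw [T.next_next_next] at this
  exact T.next_ne d this.symm

/-- Connectedness: a function on darts that is invariant under `next` and `opp` is constant. -/
lemma eq_of_invariant [Finite D] (T : SphereTriangulation D) {α : Type*} (k : D → α)
    (h1 : ∀ d, k (T.next d) = k d) (h2 : ∀ d, k (T.opp d) = k d) (d d' : D) : k d = k d' := by
  have := T.connected
  obtain ⟨⟨g, hg⟩, rfl⟩ := MulAction.exists_smul_eq (Subgroup.closure {T.next, T.opp}) d d'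
  change k d = k (g d)
  induction hg using Subgroup.closure_induction generalizing d with
  | mem g hg =>
    rcases hg with rfl | rfl
    · exact (h1 d).symm
    · exact (h2 d).symm
  | one => rfl
  | mul x y _ _ hx hy => rw [Perm.mul_apply, ← hx, ← hy]
  | inv x _ hx => rw [hx (x⁻¹ d)]; simp

variable [Fintype D] (T : SphereTriangulation D)

lemma card_darts_eq_three_mul_card_face : Fintype.card D = 3 * Nat.card T.Face := by
  refine card_eq_mul_card_cycles T.next 3 fun d => ?_
  have : {d' | T.next.SameCycle d d'} = {d, T.next d, T.next (T.next d)} := by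
    ext d'
    simp only [Set.mem_ofPred_eq, sameCycle_next_iff,
      Set.mem_insert_iff, Set.mem_singleton_iff]
  rw [this, Set.ncard_eq_three]
  exact ⟨_, _, _, (T.next_ne d).symm, (T.next_next_ne d).symm, (T.next_ne _).symm, rfl⟩

lemma card_darts_eq_two_mul_card_edge : Fintype.card D = 2 * Nat.card T.Edge := by
  refine card_eq_mul_card_cycles T.opp 2 fun d => ?_
  have : {d' | T.opp.SameCycle d d'} = {d, T.opp d} := by
    ext d'
    simp only [Set.mem_ofPred_eq, sameCycle_opp_iff,
      Set.mem_insert_iff, Set.mem_singleton_iff]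
  rw [this, Set.ncard_pair (T.opp_ne d).symm]

variable (K : Type*) [Field K]

/-- The coboundary of the dart complex: `k` goes to its increments along `next` and `opp`. -/
def coboundary : (D → K) →ₗ[K] (D ⊕ D → K) where
  toFun k := Sum.elim (fun d => k (T.next d) - k d) (fun d => k (T.opp d) - k d)
  map_add' k l := by ext (d | d) <;> simp <;> ring
  map_smul' r k := by ext (d | d) <;> simp <;> ring

/-- The transpose of the map taking increments along `next` and `opp` to their total increments
around the faces, edges and vertices. -/
def cycleBoundary : ((T.Face → K) × (T.Edge → K) × (T.Vertex → K)) →ₗ[K] (D ⊕ D → K) where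
  toFun x := Sum.elim (fun d => x.1 (T.faceOf d) - x.2.2 (T.vertexOf (T.next d)))
    (fun d => x.2.1 (T.edgeOf d) + x.2.2 (T.vertexOf (T.next d)))
  map_add' k l := by ext (d | d) <;> simp <;> ring
  map_smul' r k := by ext (d | d) <;> simp <;> ring

lemma finrank_ker_coboundary_le : Module.finrank K (LinearMap.ker (T.coboundary K)) ≤ 1 := by
  refine finrank_le_one ⟨fun _ => 1, by ext (d | d) <;> simp [coboundary]⟩ ?_
  rintro ⟨k, hk⟩
  obtain ⟨d₀⟩ := T.nonempty
  refine ⟨k d₀, ?_⟩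
  ext d
  have h1 : ∀ d, k (T.next d) = k d := fun d => sub_eq_zero.1 (congrFun hk (Sum.inl d))
  have h2 : ∀ d, k (T.opp d) = k d := fun d => sub_eq_zero.1 (congrFun hk (Sum.inr d))
  simpa using T.eq_of_invariant k h1 h2 d₀ d

lemma finrank_ker_cycleBoundary_le :
    Module.finrank K (LinearMap.ker (T.cycleBoundary K)) ≤ 1 := by
  refine finrank_le_one
    ⟨(fun _ => 1, fun _ => -1, fun _ => 1), by ext (d | d) <;> simp [cycleBoundary]⟩ ?_
  rintro ⟨⟨xF, xE, xV⟩, hx⟩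
  obtain ⟨d₀⟩ := T.nonempty
  have h1 : ∀ d, xF (T.faceOf d) = xV (T.vertexOf (T.next d)) :=
    fun d => sub_eq_zero.1 (congrFun hx (Sum.inl d))
  have h2 : ∀ d, xE (T.edgeOf d) = -xV (T.vertexOf (T.next d)) :=
    fun d => eq_neg_of_add_eq_zero_left (congrFun hx (Sum.inr d))
  have hconst : ∀ d d', xF (T.faceOf d) = xF (T.faceOf d') := by
    refine T.eq_of_invariant _ (fun d => by rw [faceOf_next]) (fun d => ?_)
    rw [h1, h1, ← neg_inj, ← h2, ← h2, edgeOf_opp]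
  refine ⟨xF (T.faceOf d₀), ?_⟩
  simp only [Subtype.ext_iff, Submodule.coe_smul, Prod.smul_mk, Prod.mk.injEq]
  refine ⟨?_, ?_, ?_⟩
  · ext q
    induction q using Quotient.inductionOn with
    | h d => exact (mul_one _).trans (hconst d₀ d)
  · ext q
    induction q using Quotient.inductionOn with
    | h d =>
      have := h2 d
      rw [← h1, hconst d d₀] at this
      exact (mul_neg_one _).trans this.symm
  · ext q
    induction q using Quotient.inductionOn with
    | h d =>
      have := h1 (T.next.symm d)
      rw [hconst _ d₀, Equiv.apply_symm_apply] at this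
      exact (mul_one _).trans this

/-- The first cohomology of the sphere vanishes: prescribed increments `a` along `next` and `b`
along `opp` are those of a function on darts as soon as their sum around every face, edge and
vertex is zero, here expressed as orthogonality to the functions constant on these cycles. -/
theorem exists_potential {K : Type*} [Field K] (a b : D → K)
    (hface : ∀ x : T.Face → K, ∑ d, x (T.faceOf d) * a d = 0)
    (hedge : ∀ x : T.Edge → K, ∑ d, x (T.edgeOf d) * b d = 0)
    (hvertex : ∀ x : T.Vertex → K, ∑ d, x (T.vertexOf (T.next d)) * (b d - a d) = 0) :
    ∃ k : D → K, ∀ d, k (T.next d) = k d + a d ∧ k (T.opp d) = k d + b d := by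
  classical
  let B : LinearMap.BilinForm K (D ⊕ D → K) := dotProductBilin K K
  have hB : ∀ u w : D ⊕ D → K, B u w = u ⬝ᵥ w := fun u w => rfl
  have hnd : B.Nondegenerate := by
    constructor
    · intro u hu
      exact dotProduct_eq_zero u hu
    · intro u hu
      exact dotProduct_eq_zero u fun w => by rw [dotProduct_comm]; exact hu w
  set W := LinearMap.range (T.cycleBoundary K) with hW
  have hmem : ∀ a b : D → K, Sum.elim a b ∈ B.orthogonal W ↔
      ∀ x : (T.Face → K) × (T.Edge → K) × (T.Vertex → K),
        ∑ d, x.1 (T.faceOf d) * a d + ∑ d, x.2.1 (T.edgeOf d) * b d +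
          ∑ d, x.2.2 (T.vertexOf (T.next d)) * (b d - a d) = 0 := by
    intro a b
    rw [LinearMap.BilinForm.mem_orthogonal_iff]
    constructor
    · intro h x
      rw [← h _ ⟨x, rfl⟩, hB, dotProduct, Fintype.sum_sum_type, ← Finset.sum_add_distrib,
        ← Finset.sum_add_distrib, ← Finset.sum_add_distrib]
      refine Finset.sum_congr rfl fun d _ => ?_
      simp only [cycleBoundary, LinearMap.coe_mk, AddHom.coe_mk, Sum.elim_inl, Sum.elim_inr]
      ring
    · rintro h _ ⟨x, rfl⟩
      rw [← h x, hB, dotProduct, Fintype.sum_sum_type, ← Finset.sum_add_distrib,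
        ← Finset.sum_add_distrib, ← Finset.sum_add_distrib]
      refine Finset.sum_congr rfl fun d _ => ?_
      simp only [cycleBoundary, LinearMap.coe_mk, AddHom.coe_mk, Sum.elim_inl, Sum.elim_inr]
      ring
  have hle : LinearMap.range (T.coboundary K) ≤ B.orthogonal W := by
    rintro _ ⟨k, rfl⟩
    refine (hmem (fun d => k (T.next d) - k d) (fun d => k (T.opp d) - k d)).2 fun x => ?_
    have e1 : ∑ d, x.1 (T.faceOf d) * k d = ∑ d, x.1 (T.faceOf d) * k (T.next d) := by
      rw [← Equiv.sum_comp T.next]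
      simp only [faceOf_next]
    have e2 : ∑ d, x.2.1 (T.edgeOf d) * k d = ∑ d, x.2.1 (T.edgeOf d) * k (T.opp d) := by
      rw [← Equiv.sum_comp T.opp]
      simp only [edgeOf_opp]
    have e3 : ∑ d, x.2.2 (T.vertexOf (T.next d)) * k (T.next d) =
        ∑ d, x.2.2 (T.vertexOf (T.next d)) * k (T.opp d) := by
      rw [Equiv.sum_comp T.next fun d => x.2.2 (T.vertexOf d) * k d,
        ← Equiv.sum_comp T.opp fun d => x.2.2 (T.vertexOf d) * k d]
      simp only [vertexOf_next]
    simp only [mul_sub, Finset.sum_sub_distrib]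
    rw [e1, e2, e3]
    ring
  have heq : LinearMap.range (T.coboundary K) = B.orthogonal W := by
    have := Fintype.ofFinite T.Face
    have := Fintype.ofFinite T.Edge
    have := Fintype.ofFinite T.Vertex
    refine Submodule.eq_of_le_of_finrank_le hle ?_
    -- with `n` darts, the left side has dimension at least `n - 1` and the right side at most
    -- `2 * n - (n + 1)`
    rw [LinearMap.BilinForm.finrank_orthogonal hnd]
    have r1 := LinearMap.finrank_range_add_finrank_ker (T.coboundary K)
    have r2 := LinearMap.finrank_range_add_finrank_ker (T.cycleBoundary K)
    have k1 := T.finrank_ker_coboundary_le K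
    have k2 := T.finrank_ker_cycleBoundary_le K
    have hE := T.card_darts_eq_two_mul_card_edge
    have hχ : Nat.card T.Vertex + Nat.card T.Face = Nat.card T.Edge + 2 := T.euler
    rw [Module.finrank_prod, Module.finrank_prod] at r2
    simp only [Module.finrank_fintype_fun_eq_card, Fintype.card_sum,
      ← Nat.card_eq_fintype_card (α := T.Face), ← Nat.card_eq_fintype_card (α := T.Edge),
      ← Nat.card_eq_fintype_card (α := T.Vertex)] at r1 r2 ⊢
    rw [← hW] at r2
    omega
  have hab : Sum.elim a b ∈ LinearMap.range (T.coboundary K) := by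
    rw [heq, hmem]
    intro x
    rw [hface, hedge, hvertex, add_zero, add_zero]
  obtain ⟨k, hk⟩ := hab
  refine ⟨k, fun d => ⟨?_, ?_⟩⟩
  · rw [← show k (T.next d) - k d = a d from congrFun hk (Sum.inl d)]
    ring
  · rw [← show k (T.opp d) - k d = b d from congrFun hk (Sum.inr d)]
    ring

end SphereTriangulation

/-! ### The fold map of a good coloring -/

lemma sum_comp_eq_sum_ncard {D Q K : Type*} [Fintype Q] [Semiring K] (s : Finset D) (g : D → Q)
    (y : Q → K) :
    ∑ d ∈ s, y (g d) = ∑ q, (({d : D | g d = q ∧ d ∈ s}.ncard : ℕ) : K) * y q := by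
  classical
  rw [← Finset.sum_fiberwise s g]
  refine Finset.sum_congr rfl fun q _ => ?_
  have : {d : D | g d = q ∧ d ∈ s} = (s.filter fun d => g d = q : Finset D) := by
    ext d
    simp [and_comm]
  rw [this, Set.ncard_coe_finset, ← nsmul_eq_mul, ← Finset.sum_const]
  refine Finset.sum_congr rfl fun d hd => ?_
  rw [(Finset.mem_filter.1 hd).2]

/-- The value at the step `ω ^ i` (with `ω` a primitive cube root of unity) of the linear functional
on the triangular lattice that is constant along the direction `1`; thus `lam (j - m)` is the
increment along `ω ^ j` of the coordinate that is constant along `ω ^ m`. -/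
def lam (i : ZMod 3) : ℤ := if i = 1 then 1 else if i = 2 then -1 else 0

lemma lam_cases : ∀ i : ZMod 3,
    (i = 0 ∧ lam i = 0 ∧ lam (i + 1) = 1 ∧ lam (i - 1) = -1) ∨
    (i ≠ 0 ∧ lam i = 1 ∧ lam (i + 1) = -1 ∧ lam (i - 1) = 0) ∨
    (i ≠ 0 ∧ lam i = -1 ∧ lam (i + 1) = 0 ∧ lam (i - 1) = 1) := by
  decide

lemma lam_sum : ∀ i : ZMod 3, lam i + lam (i - 1) + lam (i - 2) = 0 := by
  decide

namespace SphereTriangulation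

/-- The sign of the triangle of a dart: `1` if it is black and `-1` if it is white. -/
def colorSign {D : Type*} [Finite D] (T : SphereTriangulation D) (c : T.Coloring) (d : D) : ℤ :=
  if c (T.faceOf d) then 1 else -1

/-- A simplicial map from the sphere to the triangular lattice in the plane that preserves the
orientation of black triangles, reverses the orientation of white ones, and folds along exactly
the edges between a black and a white triangle. It is recorded on darts: `dir` is the direction of
the image edge, up to sign, as an exponent of a primitive cube root of unity; `orient` tells
whether the image triangle points up (`1`) or down (`-1`); `coord m` numbers the strip, among the
strips in direction `m`, that contains the image triangle. -/
structure FoldMap {D : Type*} [Finite D] (T : SphereTriangulation D) (c : T.Coloring) where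
  /-- the direction of the image of a dart, up to sign -/
  dir : D → ZMod 3
  /-- whether the image of the triangle of a dart points up or down -/
  orient : D → ℤ
  /-- the strip in a given direction that contains the image of the triangle of a dart -/
  coord : ZMod 3 → D → ℤ
  dir_next : ∀ d, dir (T.next d) = dir d + (T.colorSign c d : ZMod 3)
  dir_opp : ∀ d, dir (T.opp d) = dir d
  orient_eq : ∀ d, orient d = 1 ∨ orient d = -1
  orient_next : ∀ d, orient (T.next d) = orient d
  coord_next : ∀ m d, coord m (T.next d) = coord m d
  coord_sum : ∀ d, coord 0 d + coord 1 d + coord 2 d = -1 ∨ coord 0 d + coord 1 d + coord 2 d = -2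
  orient_opp : ∀ d, c (T.faceOf (T.opp d)) = c (T.faceOf d) → orient (T.opp d) = -orient d
  coord_opp : ∀ m d, c (T.faceOf (T.opp d)) = c (T.faceOf d) →
    coord m (T.opp d) = if dir d = m then coord m d - orient d else coord m d

variable {D : Type*} [Fintype D] (T : SphereTriangulation D)

lemma colorSign_eq (c : T.Coloring) (d : D) : T.colorSign c d = 1 ∨ T.colorSign c d = -1 := by
  unfold colorSign
  split <;> simp

lemma colorSign_next (c : T.Coloring) (d : D) :
    T.colorSign c (T.next d) = T.colorSign c d := by
  simp only [colorSign, faceOf_next]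

/-- If all degrees are even, the triangles can be signed so that the sign changes across every
edge. -/
lemma exists_orientation (heven : ∀ v, Even (T.degree v)) :
    ∃ e : D → ℤ, (∀ d, e d = 1 ∨ e d = -1) ∧ (∀ d, e (T.next d) = e d) ∧
      ∀ d, e (T.opp d) = -e d := by
  obtain ⟨E, hE⟩ := T.exists_potential (K := ZMod 2) (fun _ => 0) (fun _ => 1)
    (fun x => by simp)
    (fun x => by
      refine Finset.sum_involution (fun d _ => T.opp d) ?_ (fun d _ _ => T.opp_ne d)
        (fun d _ => Finset.mem_univ _) (fun d _ => T.opp_opp d)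
      intro d _
      rw [edgeOf_opp]
      exact CharTwo.add_self_eq_zero _)
    (fun x => by
      have := Fintype.ofFinite T.Vertex
      simp only [sub_zero, mul_one]
      rw [Equiv.sum_comp T.next fun d => x (T.vertexOf d), sum_comp_eq_sum_ncard]
      refine Finset.sum_eq_zero fun v _ => ?_
      have h0 : ((T.degree v : ℕ) : ZMod 2) = 0 := (ZMod.natCast_eq_zero_iff_even).2 (heven v)
      simp only [Finset.mem_univ, and_true]
      exact mul_eq_zero_of_left h0 _)
  refine ⟨fun d => if E d = 0 then 1 else -1, fun d => ?_, fun d => ?_, fun d => ?_⟩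
  · dsimp only
    split <;> simp
  · simp only [(hE d).1, add_zero]
  · simp only [(hE d).2]
    generalize E d = u
    revert u
    decide

/-- A good coloring assigns directions to the edges, turning by a third of a full turn
counterclockwise around black triangles and clockwise around white ones. -/
lemma exists_direction (c : T.Coloring) (hc : T.IsGood c) :
    ∃ J : D → ZMod 3, (∀ d, J (T.next d) = J d + (T.colorSign c d : ZMod 3)) ∧
      ∀ d, J (T.opp d) = J d := by
  classical
  have : Fact (Nat.Prime 3) := ⟨Nat.prime_three⟩
  obtain ⟨J, hJ⟩ := T.exists_potential (K := ZMod 3) (fun d => (T.colorSign c d : ZMod 3))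
    (fun _ => 0)
    (fun x => by
      have := Fintype.ofFinite T.Face
      have h3 : ∀ d, {d' : D | T.faceOf d' = T.faceOf d}.ncard = 3 := by
        intro d
        have : {d' : D | T.faceOf d' = T.faceOf d} = {d, T.next d, T.next (T.next d)} := by
          ext d'
          simp only [Set.mem_ofPred_eq, eq_comm (b := T.faceOf d), faceOf_eq_iff,
            Set.mem_insert_iff, Set.mem_singleton_iff]
        rw [this, Set.ncard_eq_three]
        exact ⟨_, _, _, (T.next_ne d).symm, (T.next_next_ne d).symm, (T.next_ne _).symm, rfl⟩
      have := sum_comp_eq_sum_ncard Finset.univ T.faceOf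
        (fun q => x q * ((if c q then 1 else -1 : ℤ) : ZMod 3))
      refine this.trans (Finset.sum_eq_zero fun q _ => ?_)
      induction q using Quotient.inductionOn with
      | h d =>
        have h3' := h3 d
        simp only [Finset.mem_univ, and_true]
        refine mul_eq_zero_of_left ?_ _
        rw [show {d' : D | T.faceOf d' = Quotient.mk _ d}.ncard = 3 from h3']
        rfl)
    (fun x => by simp)
    (fun x => by
      have := Fintype.ofFinite T.Vertex
      have hsum : ∑ d, x (T.vertexOf d) * (T.colorSign c d : ZMod 3) = 0 := by
        have hsplit : ∀ d, x (T.vertexOf d) * (T.colorSign c d : ZMod 3) =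
            (if c (T.faceOf d) = true then x (T.vertexOf d) else 0) -
              (if c (T.faceOf d) = false then x (T.vertexOf d) else 0) := by
          intro d
          unfold colorSign
          cases c (T.faceOf d) <;> simp
        simp only [hsplit, Finset.sum_sub_distrib, ← Finset.sum_filter]
        rw [sum_comp_eq_sum_ncard, sum_comp_eq_sum_ncard, ← Finset.sum_sub_distrib]
        refine Finset.sum_eq_zero fun v _ => ?_
        rw [← sub_mul]
        refine mul_eq_zero_of_left (sub_eq_zero.2 ?_) _
        simp only [Finset.mem_filter, Finset.mem_univ, true_and]
        exact (ZMod.natCast_eq_natCast_iff _ _ _).2 (hc v)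
      rw [← Equiv.sum_comp T.next] at hsum
      simp only [colorSign_next] at hsum
      simp [hsum])
  exact ⟨J, fun d => (hJ d).1, fun d => by simpa using (hJ d).2⟩

/-- An integral increment on darts that sums to zero around each triangle and changes sign under
reversal comes from an integral function on vertices. -/
lemma exists_position (v : D → ℤ) (hface : ∀ d, v d + v (T.next d) + v (T.next (T.next d)) = 0)
    (hedge : ∀ d, v (T.opp d) = -v d) :
    ∃ P : D → ℤ, ∀ d, P (T.next d) = P d + v d ∧ P (T.opp d) = P d + v d := by
  obtain ⟨p, hp⟩ := T.exists_potential (K := ℚ) (fun d => v d) (fun d => v d)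
    (fun x => by
      have e1 : ∑ d, x (T.faceOf d) * (v d : ℚ) = ∑ d, x (T.faceOf d) * (v (T.next d) : ℚ) := by
        rw [← Equiv.sum_comp T.next]
        simp only [faceOf_next]
      have e2 : ∑ d, x (T.faceOf d) * (v (T.next d) : ℚ) =
          ∑ d, x (T.faceOf d) * (v (T.next (T.next d)) : ℚ) := by
        rw [← Equiv.sum_comp T.next]
        simp only [faceOf_next]
      have e3 : ∑ d, x (T.faceOf d) * (v d : ℚ) + ∑ d, x (T.faceOf d) * (v (T.next d) : ℚ) +
          ∑ d, x (T.faceOf d) * (v (T.next (T.next d)) : ℚ) = 0 := by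
        rw [← Finset.sum_add_distrib, ← Finset.sum_add_distrib]
        refine Finset.sum_eq_zero fun d _ => ?_
        have : (v d : ℚ) + v (T.next d) + v (T.next (T.next d)) = 0 := by exact_mod_cast hface d
        linear_combination x (T.faceOf d) * this
      linarith)
    (fun x => by
      have e1 : ∑ d, x (T.edgeOf d) * (v d : ℚ) = -∑ d, x (T.edgeOf d) * (v d : ℚ) := by
        conv_lhs => rw [← Equiv.sum_comp T.opp]
        simp only [edgeOf_opp, hedge, Int.cast_neg, mul_neg, Finset.sum_neg_distrib]
      linarith)
    (fun x => by simp)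
  -- integral increments survive rounding down
  refine ⟨fun d => ⌊p d⌋, fun d => ⟨?_, ?_⟩⟩
  · simp only [(hp d).1, Int.floor_add_intCast]
  · simp only [(hp d).2, Int.floor_add_intCast]

theorem exists_foldMap (heven : ∀ v, Even (T.degree v)) (c : T.Coloring) (hc : T.IsGood c) :
    Nonempty (T.FoldMap c) := by
  obtain ⟨e, he, he_next, he_opp⟩ := T.exists_orientation heven
  obtain ⟨J, hJ_next, hJ_opp⟩ := T.exists_direction c hc
  have hshift : ∀ m d, (J (T.next d) - m = (J d - m) + 1 ∧ T.colorSign c d = 1) ∨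
      (J (T.next d) - m = (J d - m) - 1 ∧ T.colorSign c d = -1) := by
    intro m d
    rw [hJ_next]
    rcases T.colorSign_eq c d with h | h <;> rw [h] <;> simp <;> ring
  have hpos : ∀ m : ZMod 3, ∃ P : D → ℤ, ∀ d,
      P (T.next d) = P d + e d * lam (J d - m) ∧ P (T.opp d) = P d + e d * lam (J d - m) := by
    intro m
    refine T.exists_position _ (fun d => ?_) (fun d => by rw [he_opp, hJ_opp]; ring)
    simp only [he_next]
    have h1 := hshift m d
    have h2 := hshift m (T.next d)
    rw [colorSign_next] at h2
    rcases h1 with ⟨h1, hs⟩ | ⟨h1, hs⟩ <;> rcases h2 with ⟨h2, hs'⟩ | ⟨h2, hs'⟩ <;>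
      first
      | omega
      | (rw [h2, h1]
         generalize J d - m = i
         have h3 : lam i + lam (i + 1) + lam (i + 1 + 1) = 0 := by revert i; decide
         have h4 : lam i + lam (i - 1) + lam (i - 1 - 1) = 0 := by revert i; decide
         first
         | linear_combination e d * h3
         | linear_combination e d * h4)
  choose P₀ hP₀ using hpos
  -- normalise the three coordinates of every lattice point to have sum zero
  obtain ⟨P, hP, hPsum⟩ : ∃ P : ZMod 3 → D → ℤ, (∀ m d,
      P m (T.next d) = P m d + e d * lam (J d - m) ∧
        P m (T.opp d) = P m d + e d * lam (J d - m)) ∧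
      ∀ d, P 0 d + P 1 d + P 2 d = 0 := by
    refine ⟨fun m d => if m = 0 then -P₀ 1 d - P₀ 2 d else P₀ m d, fun m d => ?_, fun d => ?_⟩
    · by_cases hm : m = 0
      · subst hm
        have := lam_sum (J d)
        simp only [if_true, (hP₀ _ d).1, (hP₀ _ d).2, sub_zero]
        constructor <;> linear_combination -e d * this
      · simp only [hm, if_false]
        exact hP₀ m d
    · have h1 : (1 : ZMod 3) ≠ 0 := by decide
      have h2 : (2 : ZMod 3) ≠ 0 := by decide
      simp only [h1, h2, if_true, if_false]
      ring
  -- `Y m` is three times the `m`-th coordinate of the barycentre of the image triangle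
  set Y : ZMod 3 → D → ℤ := fun m d => P m d + P m (T.next d) + P m (T.next (T.next d)) with hY
  have hYsum : ∀ d, Y 0 d + Y 1 d + Y 2 d = 0 := fun d => by
    have h1 := hPsum d
    have h2 := hPsum (T.next d)
    have h3 := hPsum (T.next (T.next d))
    simp only [hY]
    linarith
  have hYval : ∀ m d, Y m d = 3 * P m d + e d * (2 * lam (J d - m) + lam (J (T.next d) - m)) := by
    intro m d
    simp only [hY, (hP m (T.next d)).1, (hP m d).1, he_next]
    ring
  have hδ : ∀ d, e d * T.colorSign c d = 1 ∨ e d * T.colorSign c d = -1 := by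
    intro d
    rcases he d with h | h <;> rcases T.colorSign_eq c d with h' | h' <;> simp [h, h']
  have hYmod : ∀ m d, ∃ q, Y m d = 3 * q + e d * T.colorSign c d := by
    intro m d
    rw [hYval]
    rcases hshift m d with ⟨h, hs⟩ | ⟨h, hs⟩ <;> rw [h, hs] <;>
      rcases lam_cases (J d - m) with ⟨_, h1, h2, h3⟩ | ⟨_, h1, h2, h3⟩ | ⟨_, h1, h2, h3⟩ <;>
      simp only [h1, h2, h3]
    · exact ⟨P m d, by ring⟩
    · exact ⟨P m d, by ring⟩
    · exact ⟨P m d - e d, by ring⟩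
    · exact ⟨P m d, by ring⟩
    · exact ⟨P m d + e d, by ring⟩
    · exact ⟨P m d, by ring⟩
  have hYopp : ∀ m d, c (T.faceOf (T.opp d)) = c (T.faceOf d) → Y m (T.opp d) =
      Y m d + (if J d = m then -2 else 1) * (e d * T.colorSign c d) := by
    intro m d hcol
    have hsign : T.colorSign c (T.opp d) = T.colorSign c d := by simp only [colorSign, hcol]
    have h' := hshift m (T.opp d)
    rw [hsign, hJ_opp] at h'
    rw [hYval, hYval, he_opp, hJ_opp, (hP m d).2]
    simp only [← sub_eq_zero (a := J d) (b := m)]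
    rcases hshift m d with ⟨h, hs⟩ | ⟨h, hs⟩ <;> rcases h' with ⟨h', hs'⟩ | ⟨h', hs'⟩ <;>
      first
      | omega
      | (rw [h, h', hs]
         rcases lam_cases (J d - m) with ⟨h0, h1, h2, h3⟩ | ⟨h0, h1, h2, h3⟩ | ⟨h0, h1, h2, h3⟩ <;>
         (simp only [h1, h2, h3]; simp only [h0, if_true, if_false]; ring))
  refine ⟨{ dir := J, orient := fun d => e d * T.colorSign c d, coord := fun m d => Y m d / 3,
            dir_next := hJ_next, dir_opp := hJ_opp, orient_eq := hδ,
            orient_next := ?_, coord_next := ?_, coord_sum := ?_, orient_opp := ?_,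
            coord_opp := ?_ }⟩
  · intro d
    simp only [he_next, colorSign_next]
  · intro m d
    simp only [hY, T.next_next_next]
    congr 1
    ring
  · intro d
    obtain ⟨q0, h0⟩ := hYmod 0 d
    obtain ⟨q1, h1⟩ := hYmod 1 d
    obtain ⟨q2, h2⟩ := hYmod 2 d
    have := hYsum d
    rcases hδ d with h | h <;> rw [h] at h0 h1 h2 <;> simp only [h0, h1, h2] at this ⊢ <;> omega
  · intro d hcol
    simp only [he_opp, colorSign, hcol]
    ring
  · intro m d hcol
    obtain ⟨q, hq⟩ := hYmod m d
    have := hYopp m d hcol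
    rcases hδ d with h | h <;> rw [h] at hq this <;> simp only [h] <;> split_ifs at this ⊢ <;>
      omega

end SphereTriangulation

/-! ### Folds across strips and the isoperimetric inequality -/

namespace SphereTriangulation

/-- Marking exactly one dart of every triangle selects a third of the darts of any set of
triangles. -/
lemma three_mul_card_filter {D : Type*} [Fintype D] (T : SphereTriangulation D) (Z P : D → Prop)
    [DecidablePred Z] [DecidablePred P]
    (hZ : ∀ d, Z (T.next d) ↔ Z d)
    (hP : ∀ d, (P d ∧ ¬P (T.next d) ∧ ¬P (T.next (T.next d))) ∨
      (¬P d ∧ P (T.next d) ∧ ¬P (T.next (T.next d))) ∨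
      (¬P d ∧ ¬P (T.next d) ∧ P (T.next (T.next d)))) :
    3 * (Finset.univ.filter fun d => Z d ∧ P d).card = (Finset.univ.filter fun d => Z d).card := by
  have e1 : ∑ d, (if Z d ∧ P d then 1 else 0) = ∑ d, (if Z d ∧ P (T.next d) then 1 else 0) := by
    rw [← Equiv.sum_comp T.next]
    simp only [hZ]
  have e2 : ∑ d, (if Z d ∧ P (T.next d) then 1 else 0) =
      ∑ d, (if Z d ∧ P (T.next (T.next d)) then 1 else 0) := by
    rw [← Equiv.sum_comp T.next]
    simp only [hZ]
  have e3 : ∑ d, (if Z d ∧ P d then 1 else 0) + ∑ d, (if Z d ∧ P (T.next d) then 1 else 0) +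
      ∑ d, (if Z d ∧ P (T.next (T.next d)) then 1 else 0) = ∑ d, (if Z d then 1 else 0) := by
    rw [← Finset.sum_add_distrib, ← Finset.sum_add_distrib]
    refine Finset.sum_congr rfl fun d _ => ?_
    by_cases h : Z d <;> rcases hP d with ⟨h1, h2, h3⟩ | ⟨h1, h2, h3⟩ | ⟨h1, h2, h3⟩ <;>
      simp [h, h1, h2, h3]
  rw [Finset.card_filter, Finset.card_filter]
  omega

/-- A dart of a triangle of color `b` along which the coloring folds. -/
def IsFold {D : Type*} [Finite D] (T : SphereTriangulation D) (c : T.Coloring) (b : Bool) (d : D) :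
    Prop :=
  c (T.faceOf d) = b ∧ c (T.faceOf (T.opp d)) = !b

namespace FoldMap

variable {D : Type*} [Fintype D] {T : SphereTriangulation D} {c : T.Coloring} (φ : T.FoldMap c)

/-- The position of the image triangle within its strip in direction `m`. -/
def index (m : ZMod 3) (d : D) : ℤ := φ.coord (m + 1) d - φ.coord (m + 2) d

/-- How a dart leads out of the image triangle within its strip in direction `m`: backwards (`1`),
forwards (`-1`), or across the boundary of the strip (`0`). -/
def exit (m : ZMod 3) (d : D) : ℤ := φ.orient d * lam (φ.dir d - m)

lemma index_next (m : ZMod 3) (d : D) : φ.index m (T.next d) = φ.index m d := by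
  simp only [index, coord_next]

lemma dir_next_cases (m : ZMod 3) (d : D) :
    (φ.dir (T.next d) - m = (φ.dir d - m) + 1 ∧
      φ.dir (T.next (T.next d)) - m = (φ.dir d - m) - 1) ∨
    (φ.dir (T.next d) - m = (φ.dir d - m) - 1 ∧
      φ.dir (T.next (T.next d)) - m = (φ.dir d - m) + 1) := by
  rw [φ.dir_next (T.next d), φ.dir_next d, colorSign_next]
  generalize φ.dir d = i
  rcases T.colorSign_eq c d with h | h <;> rw [h] <;> revert i m <;> decide

lemma exit_cases (m : ZMod 3) (s : ℤ) (hs : s = 1 ∨ s = -1) (d : D) :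
    (φ.exit m d = s ∧ ¬φ.exit m (T.next d) = s ∧ ¬φ.exit m (T.next (T.next d)) = s) ∨
    (¬φ.exit m d = s ∧ φ.exit m (T.next d) = s ∧ ¬φ.exit m (T.next (T.next d)) = s) ∨
    (¬φ.exit m d = s ∧ ¬φ.exit m (T.next d) = s ∧ φ.exit m (T.next (T.next d)) = s) := by
  simp only [exit, φ.orient_next]
  rcases φ.dir_next_cases m d with ⟨h, h'⟩ | ⟨h, h'⟩ <;> rw [h, h'] <;>
    rcases lam_cases (φ.dir d - m) with ⟨_, h1, h2, h3⟩ | ⟨_, h1, h2, h3⟩ | ⟨_, h1, h2, h3⟩ <;>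
    rcases φ.orient_eq d with ho | ho <;> rcases hs with rfl | rfl <;> simp [h1, h2, h3, ho]

lemma dir_cases (m : ZMod 3) (d : D) :
    (φ.dir d = m ∧ ¬φ.dir (T.next d) = m ∧ ¬φ.dir (T.next (T.next d)) = m) ∨
    (¬φ.dir d = m ∧ φ.dir (T.next d) = m ∧ ¬φ.dir (T.next (T.next d)) = m) ∨
    (¬φ.dir d = m ∧ ¬φ.dir (T.next d) = m ∧ φ.dir (T.next (T.next d)) = m) := by
  simp only [← sub_eq_zero (b := m)]
  rcases φ.dir_next_cases m d with ⟨h, h'⟩ | ⟨h, h'⟩ <;> rw [h, h'] <;>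
    generalize φ.dir d - m = i <;> revert i <;> decide

lemma exit_opp (m : ZMod 3) (d : D) (h : c (T.faceOf (T.opp d)) = c (T.faceOf d)) :
    φ.exit m (T.opp d) = -φ.exit m d := by
  simp only [exit, φ.orient_opp d h, φ.dir_opp]
  ring

lemma index_opp (m : ZMod 3) (d : D) (h : c (T.faceOf (T.opp d)) = c (T.faceOf d)) :
    φ.index m (T.opp d) = φ.index m d - φ.exit m d := by
  simp only [index, exit, φ.coord_opp _ d h]
  have key : ∀ i m : ZMod 3, (i = m + 1 ∧ i ≠ m + 2 ∧ lam (i - m) = 1) ∨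
      (i ≠ m + 1 ∧ i = m + 2 ∧ lam (i - m) = -1) ∨
      (i ≠ m + 1 ∧ i ≠ m + 2 ∧ lam (i - m) = 0) := by decide
  rcases key (φ.dir d) m with ⟨h1, h2, h3⟩ | ⟨h1, h2, h3⟩ | ⟨h1, h2, h3⟩ <;> rw [h3]
  · rw [if_pos h1, if_neg h2]
    ring
  · rw [if_neg h1, if_pos h2]
    ring
  · rw [if_neg h1, if_neg h2]
    ring

lemma dir_ne_of_exit_ne_zero (m : ZMod 3) (d : D) (h : φ.exit m d ≠ 0) : φ.dir d ≠ m := by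
  rintro rfl
  have h0 : lam 0 = 0 := by decide
  simp [exit, h0] at h

lemma coord_opp_of_exit_ne_zero (m : ZMod 3) (d : D)
    (h : c (T.faceOf (T.opp d)) = c (T.faceOf d)) (hd : φ.exit m d ≠ 0) :
    φ.coord m (T.opp d) = φ.coord m d := by
  rw [φ.coord_opp m d h, if_neg (φ.dir_ne_of_exit_ne_zero m d hd)]

open scoped Classical in
/-- The triangles of color `b` over a given cell of a strip are at most as many as the folds along
the edges by which cells of the strip, from the given one onwards to side `s`, exit to side `s`: an
exiting edge that is not a fold leads to another triangle of color `b`, over the next cell. Three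
darts on the left account for one triangle. -/
lemma card_cell_le_card_folds_side (b : Bool) (m : ZMod 3) (x i s : ℤ) (hs : s = 1 ∨ s = -1) :
    (Finset.univ.filter fun d => c (T.faceOf d) = b ∧ φ.coord m d = x ∧ φ.index m d = i).card ≤
      3 * (Finset.univ.filter fun d => T.IsFold c b d ∧ φ.coord m d = x ∧ φ.exit m d = s).card := by
  have hs' : -s = 1 ∨ -s = -1 := by omega
  have hs0 : s ≠ 0 := by omega
  -- `Z` consists of the given cell and the cells of the strip on side `s` of it
  let Z : D → Prop := fun d => c (T.faceOf d) = b ∧ φ.coord m d = x ∧ s * φ.index m d ≤ s * i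
  have hZ : ∀ d, Z (T.next d) ↔ Z d := fun d => by
    simp only [Z, faceOf_next, coord_next, index_next]
  have c1 := T.three_mul_card_filter Z _ hZ (φ.exit_cases m s hs)
  have c2 := T.three_mul_card_filter Z _ hZ (φ.exit_cases m (-s) hs')
  have c3 := T.three_mul_card_filter
    (fun d => c (T.faceOf d) = b ∧ φ.coord m d = x ∧ φ.index m d = i) _
    (fun d => by simp only [faceOf_next, coord_next, index_next]) (φ.exit_cases m (-s) hs')
  set L := Finset.univ.filter fun d => (c (T.faceOf d) = b ∧ φ.coord m d = x ∧
    s * φ.index m d < s * i) ∧ φ.exit m d = -s with hL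
  set M := Finset.univ.filter fun d => (c (T.faceOf d) = b ∧ φ.coord m d = x ∧
    φ.index m d = i) ∧ φ.exit m d = -s with hM
  set R := Finset.univ.filter fun d => T.IsFold c b d ∧ φ.coord m d = x ∧ φ.exit m d = s with hR
  have hLM : L.card + M.card ≤ (Finset.univ.filter fun d => Z d ∧ φ.exit m d = -s).card := by
    rw [← Finset.card_union_of_disjoint]
    · refine Finset.card_le_card fun d hd => ?_
      simp only [hL, hM, Finset.mem_union, Finset.mem_filter, Finset.mem_univ, true_and] at hd
      simp only [Z, Finset.mem_filter, Finset.mem_univ, true_and]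
      rcases hd with hd | hd
      · exact ⟨⟨hd.1.1, hd.1.2.1, hd.1.2.2.le⟩, hd.2⟩
      · exact ⟨⟨hd.1.1, hd.1.2.1, by rw [hd.1.2.2]⟩, hd.2⟩
    · rw [Finset.disjoint_left]
      intro d hd hd'
      simp only [hL, hM, Finset.mem_filter, Finset.mem_univ, true_and] at hd hd'
      rw [hd'.1.2.2] at hd
      exact lt_irrefl _ hd.1.2.2
  have hcross : (Finset.univ.filter fun d => Z d ∧ φ.exit m d = s).card ≤ R.card + L.card := by
    have hsub : (Finset.univ.filter fun d => Z d ∧ φ.exit m d = s) ⊆ R ∪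
        L.image T.opp := by
      intro d hd
      simp only [Z, Finset.mem_filter, Finset.mem_univ, true_and] at hd
      obtain ⟨⟨hb, hx, hi⟩, hd⟩ := hd
      rw [Finset.mem_union]
      by_cases hcol : c (T.faceOf (T.opp d)) = c (T.faceOf d)
      · right
        refine Finset.mem_image.2 ⟨T.opp d, ?_, T.opp_opp d⟩
        simp only [hL, Finset.mem_filter, Finset.mem_univ, true_and]
        refine ⟨⟨hcol.trans hb, ?_, ?_⟩, ?_⟩
        · rw [φ.coord_opp_of_exit_ne_zero m d hcol (by rw [hd]; exact hs0), hx]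
        · rw [φ.index_opp m d hcol, hd]
          rcases hs with rfl | rfl <;> omega
        · rw [φ.exit_opp m d hcol, hd]
      · left
        simp only [hR, Finset.mem_filter, Finset.mem_univ, true_and]
        refine ⟨⟨hb, ?_⟩, hx, hd⟩
        rw [hb] at hcol
        exact Bool.eq_not.2 hcol
    refine (Finset.card_le_card hsub).trans ((Finset.card_union_le _ _).trans ?_)
    exact Nat.add_le_add_left Finset.card_image_le _
  omega

open scoped Classical in
/-- Half of the folds across a strip bound the number of triangles over each of its cells (three
darts of which account for one triangle). -/
lemma two_mul_card_cell_le (b : Bool) (m : ZMod 3) (x i : ℤ) :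
    2 * (Finset.univ.filter fun d => c (T.faceOf d) = b ∧ φ.coord m d = x ∧
        φ.index m d = i).card ≤
      3 * (Finset.univ.filter fun d => T.IsFold c b d ∧ φ.coord m d = x ∧ φ.dir d ≠ m).card := by
  have h1 := φ.card_cell_le_card_folds_side b m x i 1 (Or.inl rfl)
  have h2 := φ.card_cell_le_card_folds_side b m x i (-1) (Or.inr rfl)
  have h3 : (Finset.univ.filter fun d => T.IsFold c b d ∧ φ.coord m d = x ∧
        φ.exit m d = 1).card +
      (Finset.univ.filter fun d => T.IsFold c b d ∧ φ.coord m d = x ∧ φ.exit m d = -1).card ≤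
      (Finset.univ.filter fun d => T.IsFold c b d ∧ φ.coord m d = x ∧ φ.dir d ≠ m).card := by
    rw [← Finset.card_union_of_disjoint]
    · refine Finset.card_le_card fun d hd => ?_
      simp only [Finset.mem_union, Finset.mem_filter, Finset.mem_univ, true_and] at hd ⊢
      rcases hd with ⟨h, h', h''⟩ | ⟨h, h', h''⟩ <;>
        exact ⟨h, h', φ.dir_ne_of_exit_ne_zero m d (by rw [h'']; decide)⟩
    · rw [Finset.disjoint_left]
      intro d hd hd'
      simp only [Finset.mem_filter, Finset.mem_univ, true_and] at hd hd'
      omega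
  omega

open scoped Classical in
/-- The isoperimetric inequality for the image of the triangles of one color. -/
theorem two_mul_card_color_le (φ : T.FoldMap c) (b : Bool) :
    2 * (Finset.univ.filter fun d => c (T.faceOf d) = b).card ≤
      (Finset.univ.filter fun d => T.IsFold c b d).card ^ 2 := by
  let α : ZMod 3 → ℤ → ℕ := fun m x =>
    (Finset.univ.filter fun d => T.IsFold c b d ∧ φ.coord m d = x ∧ φ.dir d ≠ m).card / 2
  let w : ℤ × ℤ × ℤ → ℕ := fun t => (Finset.univ.filter fun d => (c (T.faceOf d) = b ∧
    (φ.coord 0 d, φ.coord 1 d, φ.coord 2 d) = t) ∧ φ.dir d = 0).card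
  let I : Finset ℤ := Finset.univ.biUnion fun m => Finset.univ.image (φ.coord m)
  have hI : ∀ m d, φ.coord m d ∈ I := fun m d =>
    Finset.mem_biUnion.2 ⟨m, Finset.mem_univ _, Finset.mem_image_of_mem _ (Finset.mem_univ _)⟩
  have hw3 : ∀ t, 3 * w t = (Finset.univ.filter fun d => c (T.faceOf d) = b ∧
      (φ.coord 0 d, φ.coord 1 d, φ.coord 2 d) = t).card := fun t =>
    T.three_mul_card_filter _ _ (fun d => by simp only [faceOf_next, coord_next]) (φ.dir_cases 0)
  have hstrip : ∀ m x i t, (∀ d, (φ.coord 0 d, φ.coord 1 d, φ.coord 2 d) = t →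
      φ.coord m d = x ∧ φ.index m d = i) → w t ≤ α m x := by
    intro m x i t h
    have h1 := φ.two_mul_card_cell_le b m x i
    have h2 : (Finset.univ.filter fun d => c (T.faceOf d) = b ∧
        (φ.coord 0 d, φ.coord 1 d, φ.coord 2 d) = t).card ≤ (Finset.univ.filter fun d =>
        c (T.faceOf d) = b ∧ φ.coord m d = x ∧ φ.index m d = i).card :=
      Finset.card_le_card fun d hd => by
        simp only [Finset.mem_filter, Finset.mem_univ, true_and] at hd ⊢
        exact ⟨hd.1, h d hd.2⟩
    rw [← hw3] at h2
    exact (Nat.le_div_iff_mul_le two_pos).2 (by omega)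
  have hmain := six_mul_sum_le_sq I (α 0) (α 1) (α 2) w
    (fun t => hstrip 0 t.1 (t.2.1 - t.2.2) t fun d hd => by subst hd; exact ⟨rfl, rfl⟩)
    (fun t => hstrip 1 t.2.1 (t.2.2 - t.1) t fun d hd => by subst hd; exact ⟨rfl, rfl⟩)
    (fun t => hstrip 2 t.2.2 (t.1 - t.2.1) t fun d hd => by subst hd; exact ⟨rfl, rfl⟩)
    (fun t ht => by
      obtain ⟨d, hd⟩ := Finset.card_pos.1 (Nat.pos_of_ne_zero ht)
      simp only [Finset.mem_filter, Finset.mem_univ, true_and] at hd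
      rw [← hd.1.2]
      exact φ.coord_sum d)
  have hsum : 3 * ∑ t ∈ I ×ˢ I ×ˢ I, w t =
      (Finset.univ.filter fun d => c (T.faceOf d) = b).card := by
    rw [Finset.mul_sum, Finset.card_eq_sum_card_fiberwise
      (f := fun d => (φ.coord 0 d, φ.coord 1 d, φ.coord 2 d)) (t := I ×ˢ I ×ˢ I)]
    · refine Finset.sum_congr rfl fun t _ => ?_
      rw [hw3, Finset.filter_filter]
    · intro d _
      simp [hI]
  have hα : ∀ m, 2 * ∑ x ∈ I, α m x ≤
      (Finset.univ.filter fun d => T.IsFold c b d ∧ φ.dir d ≠ m).card := by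
    intro m
    rw [Finset.mul_sum, Finset.card_eq_sum_card_fiberwise (f := φ.coord m) (t := I)]
    · refine Finset.sum_le_sum fun x _ => (Nat.mul_div_le _ 2).trans (le_of_eq ?_)
      rw [Finset.filter_filter]
      congr 1
      ext d
      simp only [Finset.mem_filter, Finset.mem_univ, true_and]
      tauto
    · intro d _
      exact hI m d
  -- each fold crosses the strips of two of the three directions
  have htwo : (Finset.univ.filter fun d => T.IsFold c b d ∧ φ.dir d ≠ 0).card +
      (Finset.univ.filter fun d => T.IsFold c b d ∧ φ.dir d ≠ 1).card +
      (Finset.univ.filter fun d => T.IsFold c b d ∧ φ.dir d ≠ 2).card =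
      2 * (Finset.univ.filter fun d => T.IsFold c b d).card := by
    simp only [Finset.card_filter, Finset.mul_sum, ← Finset.sum_add_distrib]
    refine Finset.sum_congr rfl fun d _ => ?_
    by_cases h : T.IsFold c b d
    · simp only [h, true_and, if_true]
      generalize φ.dir d = j
      revert j
      decide
    · simp [h]
  have h0 := hα 0
  have h1 := hα 1
  have h2 := hα 2
  have hle : ∑ x ∈ I, α 0 x + ∑ x ∈ I, α 1 x + ∑ x ∈ I, α 2 x ≤
      (Finset.univ.filter fun d => T.IsFold c b d).card := by omega
  have hsq := Nat.pow_le_pow_left hle 2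
  omega

end FoldMap

variable {D : Type*} [Fintype D] (T : SphereTriangulation D)

open scoped Classical in
lemma card_isFold_true_eq_foldCount (c : T.Coloring) :
    (Finset.univ.filter fun d => T.IsFold c true d).card = T.foldCount c := by
  have h : {e : T.Edge | ∃ d : D, T.edgeOf d = e ∧ c (T.faceOf d) = true ∧
      c (T.faceOf (T.opp d)) = false} =
      T.edgeOf '' (Finset.univ.filter fun d => T.IsFold c true d : Finset D) := by
    ext e
    simp only [IsFold, Set.mem_ofPred_eq, Set.mem_image, Finset.coe_filter, Finset.mem_univ,
      true_and, Bool.not_true]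
    exact exists_congr fun d => and_comm
  rw [foldCount, h, Set.InjOn.ncard_image, Set.ncard_coe_finset]
  intro d hd d' hd' he
  have hd := (Finset.mem_filter.1 (Finset.mem_coe.1 hd)).2
  have hd' := (Finset.mem_filter.1 (Finset.mem_coe.1 hd')).2
  rcases T.edgeOf_eq_iff.1 he with rfl | rfl
  · rfl
  · simp [IsFold, hd.2] at hd'

open scoped Classical in
lemma card_isFold_false_eq_card_isFold_true (c : T.Coloring) :
    (Finset.univ.filter fun d => T.IsFold c false d).card =
      (Finset.univ.filter fun d => T.IsFold c true d).card := by
  refine Finset.card_equiv T.opp fun d => ?_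
  simp only [IsFold, T.opp_opp, Finset.mem_filter, Finset.mem_univ, true_and, Bool.not_true,
    Bool.not_false]
  exact and_comm

lemma three_mul_card_face_le_sq (heven : ∀ v, Even (T.degree v)) (c : T.Coloring)
    (hc : T.IsGood c) : 3 * Nat.card T.Face ≤ T.foldCount c ^ 2 := by
  classical
  obtain ⟨φ⟩ := T.exists_foldMap heven c hc
  have h1 := φ.two_mul_card_color_le true
  have h2 := φ.two_mul_card_color_le false
  rw [card_isFold_false_eq_card_isFold_true] at h2
  rw [card_isFold_true_eq_foldCount] at h1 h2
  have h3 := Finset.card_filter_add_card_filter_not (s := (Finset.univ : Finset D))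
    (fun d => c (T.faceOf d) = true)
  simp only [Bool.not_eq_true, Finset.card_univ] at h3
  rw [T.card_darts_eq_three_mul_card_face] at h3
  omega

end SphereTriangulation

theorem theorem1p2 {D : Type*} [Finite D] (T : SphereTriangulation D)
    (hT : T.HasDegreeSequenceSixTwoTwoTwo) (c : T.Coloring) (hc : T.IsGood c) :
    3 ≤ T.eta c := by
  have := Fintype.ofFinite D
  have heven : ∀ v, Even (T.degree v) := by
    intro v
    by_cases h : T.degree v = 2
    · rw [h]
      decide
    · rw [hT.2 v h]
      decide
  have hmain := T.three_mul_card_face_le_sq heven c hc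
  obtain ⟨d₀⟩ := T.nonempty
  have : Nonempty T.Face := ⟨T.faceOf d₀⟩
  have hpos : 0 < Nat.card T.Face := Nat.card_pos
  rw [SphereTriangulation.eta, le_div_iff₀ (by exact_mod_cast hpos)]
  exact_mod_cast hmain
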